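/- Let $f,g:\mathbb R\to[0,\infty)$ be Borel measurable with $g(u)\neq 0$ for $u\neq 0$. Let $(\chi_n)_{n\in\mathbb N}$ be independent real random variables on a probability space $(\Omega,\mathcal F,\mathbb P)$ such that $\mathbb E\chi_n=0$, $\mathbb E\chi_n^2=1$, $\sup_n\mathbb E|\chi_n|^3<\infty$, and each $\chi_n$ has a probability density function $p_n$ with $x^3p_n(x)\to0$ as $|x|\to\infty$, uniformly in $n$. For $\bar h>0$ and $\varsigma>0$ let $(X_n)_{n\ge 0}$ be the solution of $$X_{n+1}=X_n\bigl(1+h_nf(X_n)+\sqrt{h_n}\,g(X_n)\chi_{n+1}\bigr),\qquad X_0=\varsigma,\qquad h_n=\frac{\bar h}{1+f(X_n)+g^2(X_n)} .$$ (i) If $f$ and $g$ are continuous on $\mathbb R\setminus\{0\}$ and $\sup_{u\ne0}\frac{2f(u)}{g^2(u)}<1$, then there exists $h_0>0$ such that for all $\bar h\in(0,h_0]$ and all $\varsigma>0$, $\lim_{n\to\infty}X_n=0$ almost surely. (ii) If $\liminf_{u\to0}\frac{2f(u)}{g^2(u)}>1$ (the value $+\infty$ being allowed), then there exists $h_0>0$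 such that for all $\bar h\in(0,h_0]$ and all $\varsigma>0$, $\mathbb P\bigl[\lim_{n\to\infty}X_n=0\bigr]=0$. -/

import Mathlib

open MeasureTheory ProbabilityTheory Filter Topology

/-- Coefficients `f, g : ℝ → [0, ∞)`, Borel measurable, with `g u ≠ 0` for `u ≠ 0`. -/
structure IsCoefficientPair (f g : ℝ → ℝ) : Prop where
  measurable_f : Measurable f
  measurable_g : Measurable g
  f_nonneg : ∀ u, 0 ≤ f u
  g_nonneg : ∀ u, 0 ≤ g u
  g_ne_zero : ∀ u, u ≠ 0 → g u ≠ 0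

/-- Independent noise with mean `0`, variance `1`, uniformly bounded third absolute moments, and
probability densities `p n` such that `x ^ 3 * p n x → 0` as `|x| → ∞`, uniformly in `n`. -/
structure IsNoise {Ω : Type*} [MeasurableSpace Ω] (P : Measure Ω) (χ : ℕ → Ω → ℝ) : Prop where
  measurable : ∀ n, Measurable (χ n)
  indep : iIndepFun χ P
  mean : ∀ n, Integrable (χ n) P ∧ ∫ ω, χ n ω ∂P = 0
  second_moment : ∀ n, Integrable (fun ω => χ n ω ^ 2) P ∧ ∫ ω, χ n ω ^ 2 ∂P = 1
  third_moment : ∃ K : ℝ, ∀ n,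
    Integrable (fun ω => |χ n ω| ^ 3) P ∧ ∫ ω, |χ n ω| ^ 3 ∂P ≤ K
  density : ∃ p : ℕ → ℝ → ℝ,
    (∀ n, Measurable (p n)) ∧
    (∀ n x, 0 ≤ p n x) ∧
    (∀ n, P.map (χ n) = volume.withDensity (fun x => ENNReal.ofReal (p n x))) ∧
    (∀ ε : ℝ, 0 < ε → ∃ R : ℝ, ∀ n x, R ≤ |x| → |x ^ 3 * p n x| ≤ ε)

/-- The adaptive step `h̄ / (1 + f x + g x ^ 2)` taken from the state `x`. -/
noncomputable def adaptiveStep (f g : ℝ → ℝ) (hbar x : ℝ) : ℝ :=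
  hbar / (1 + f x + g x ^ 2)

/-- `X` solves `X (n+1) = X n * (1 + h n * f (X n) + √(h n) * g (X n) * χ (n+1))`, `X 0 = ς`,
where `h n = h̄ / (1 + f (X n) + g (X n) ^ 2)`. -/
structure IsAdaptiveSolution {Ω : Type*} (f g : ℝ → ℝ) (hbar : ℝ) (χ : ℕ → Ω → ℝ) (ς : ℝ)
    (X : ℕ → Ω → ℝ) : Prop where
  init : ∀ ω, X 0 ω = ς
  step : ∀ n ω, X (n + 1) ω =
    X n ω * (1 + adaptiveStep f g hbar (X n ω) * f (X n ω)
      + √(adaptiveStep f g hbar (X n ω)) * g (X n ω) * χ (n + 1) ω)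

/-! Write one step as `X (n+1) = X n * (1 + a + b χ)` with `a = h f` and `b = √h g`; the adaptive
step gives `a ≤ h̄` and `b ^ 2 ≤ h̄` for every state. For small `r` of either sign, the mean of `|1
+ a + bχ| ^ r` is at most `1 + r a - r (1 - r) / 2 * b ^ 2` up to errors absorbed by small `h̄`, so
the comparison of `2 f` with `g ^ 2` fixes the drift of `|X| ^ r`.

Stability takes `r = q > 0`: `|X n| ^ q` is a nonnegative supermartingale losing a multiple of `b ^
2 |X n| ^ q` at each step. It converges, the losses are summable, and their positivity and
continuity off `0` force the limit to be `0` (`one_step_stable`, `ae_tendsto_of_dissipation`,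
`tendsto_zero_of_dissipation`).

Instability takes `r = -q < 0`. Taylor expansion fails near `1 + a + bχ = 0`, but that event needs
`|χ|` of order `1 / b`, where the density is at most `8 ε b ^ 3`; after rescaling it costs `O(ε b ^
2)`, which the drift absorbs (`lintegral_singular_part_le`, `one_step_unstable`). Hence the moment
of order `-q` does not grow while `X` stays near `0`, and Fatou excludes `|X n| ^ (-q) → ∞`
(`ae_not_tendsto_zero`). -/

/-! ### Cubic majorants of powers of `|1 + y|`. -/

theorem rpow_one_add_le_cubic {p y : ℝ} (hp : |p| ≤ 1) (hy : |y| ≤ 1 / 2) :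
    (1 + y) ^ p ≤ 1 + p * y + p * (p - 1) / 2 * y ^ 2 + 20 * |y| ^ 3 := by
  have hy0 := abs_nonneg y
  have h1 : 0 < 1 + y := by linarith [neg_abs_le y]
  have hlog : |Real.log (1 + y) - (y - y ^ 2 / 2)| ≤ 2 * |y| ^ 3 := by
    have h := Real.abs_log_sub_add_sum_range_le (x := -y) (by rw [abs_neg]; linarith) 2
    simp only [Finset.sum_range_succ, Finset.sum_range_zero, abs_neg, sub_neg_eq_add] at h
    have h3 : |y| ^ 3 / (1 - |y|) ≤ 2 * |y| ^ 3 := by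
      rw [div_le_iff₀ (by linarith)]
      nlinarith [pow_nonneg hy0 3]
    refine (le_of_eq ?_).trans (h.trans (by simpa using h3))
    congr 1
    push_cast
    ring
  set l := Real.log (1 + y) with hl
  have hyy : |y| ^ 2 = y ^ 2 := sq_abs y
  have hy3 : |y| ^ 3 = |y| * y ^ 2 := by rw [← hyy]; ring
  have hy2 : y ^ 2 ≤ |y| / 2 := by rw [← hyy]; nlinarith
  have hly : |l - y| ≤ 3 / 2 * y ^ 2 := by
    have : l - y = (l - (y - y ^ 2 / 2)) + -(y ^ 2 / 2) := by ring
    rw [this]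
    refine (abs_add_le _ _).trans ?_
    rw [abs_neg, abs_of_nonneg (by positivity : 0 ≤ y ^ 2 / 2)]
    nlinarith [sq_nonneg y]
  have hlb : |l| ≤ 2 * |y| := by
    have : l = (l - y) + y := by ring
    rw [this]
    refine (abs_add_le _ _).trans ?_
    linarith
  have hl2 : l ^ 2 ≤ y ^ 2 + 5 * |y| ^ 3 := by
    have e : l ^ 2 - y ^ 2 = (l - y) * (l + y) := by ring
    have h2 : |l + y| ≤ 3 * |y| := (abs_add_le _ _).trans (by linarith)
    have h4 : (l - y) * (l + y) ≤ 3 / 2 * y ^ 2 * (3 * |y|) := by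
      refine (le_abs_self _).trans ?_
      rw [abs_mul]
      gcongr
    nlinarith [pow_nonneg hy0 3]
  have hpl : |p * l| ≤ 2 * |y| := by
    rw [abs_mul]
    nlinarith [abs_nonneg l, abs_nonneg p]
  have hexp := Real.exp_bound (x := p * l) (by linarith) (n := 3) (by norm_num)
  have hcube : |p * l| ^ 3 ≤ 8 * |y| ^ 3 := by
    calc |p * l| ^ 3 ≤ (2 * |y|) ^ 3 := by gcongr
      _ = 8 * |y| ^ 3 := by ring
  have hexp' : Real.exp (p * l) ≤ 1 + p * l + (p * l) ^ 2 / 2 + 8 * |y| ^ 3 := by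
    have := (abs_le.1 hexp).2
    simp only [Finset.sum_range_succ, Finset.sum_range_zero] at this
    norm_num [Nat.factorial] at this
    rw [← abs_mul] at this
    nlinarith [pow_nonneg (abs_nonneg (p * l)) 3]
  have hlin : p * l ≤ p * (y - y ^ 2 / 2) + 2 * |y| ^ 3 := by
    have : p * (l - (y - y ^ 2 / 2)) ≤ 2 * |y| ^ 3 := by
      refine (le_abs_self _).trans ?_
      rw [abs_mul]
      nlinarith [abs_nonneg (l - (y - y ^ 2 / 2)), abs_nonneg p]
    linarith
  have hp2 : p ^ 2 ≤ 1 := by rw [← sq_abs]; nlinarith [abs_nonneg p]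
  have hquad : (p * l) ^ 2 ≤ p ^ 2 * y ^ 2 + 5 * |y| ^ 3 := by
    rw [mul_pow]
    nlinarith [mul_le_mul_of_nonneg_left hl2 (sq_nonneg p), pow_nonneg hy0 3]
  rw [Real.rpow_def_of_pos h1, ← hl, mul_comm l p]
  nlinarith [pow_nonneg hy0 3]

/-- For `|y| > 1 / 2` Bernoulli's inequality gives linear growth, and `|y| ^ 3` dominates the lower
powers. -/
theorem abs_one_add_rpow_le_cubic {p : ℝ} (hp0 : 0 < p) (hp1 : p ≤ 1) (y : ℝ) :
    |1 + y| ^ p ≤ 1 + p * y + p * (p - 1) / 2 * y ^ 2 + 20 * |y| ^ 3 := by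
  rcases le_or_gt |y| (1 / 2) with hy | hy
  · rw [abs_of_pos (by linarith [neg_abs_le y])]
    exact rpow_one_add_le_cubic (by rwa [abs_of_pos hp0]) hy
  · have h1 : |1 + y| ^ p ≤ 1 + p * |y| := by
      calc |1 + y| ^ p ≤ (1 + |y|) ^ p := by
            gcongr
            exact (abs_add_le _ _).trans (by simp)
        _ ≤ _ := rpow_one_add_le_one_add_mul_self (by linarith) hp0.le hp1
    have hyy : |y| ^ 2 = y ^ 2 := sq_abs y
    have h2 : p * |y| - p * y ≤ 2 * |y| := by nlinarith [neg_abs_le y, abs_nonneg y]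
    have h3 : p * (1 - p) / 2 * y ^ 2 ≤ y ^ 2 :=
      mul_le_of_le_one_left (sq_nonneg y) (by nlinarith)
    have h4 : 2 * |y| ≤ 8 * |y| ^ 3 := by nlinarith [abs_nonneg y]
    have h5 : y ^ 2 ≤ 2 * |y| ^ 3 := by rw [← hyy]; nlinarith [sq_nonneg |y|]
    nlinarith [pow_nonneg (abs_nonneg y) 3]

theorem cubic_nonneg_of_near_neg_one {p y : ℝ} (hp0 : 0 < p) (hy : |1 + y| < 1 / 2) :
    0 ≤ 1 - p * y + p * (p + 1) / 2 * y ^ 2 + 20 * |y| ^ 3 := by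
  have : y ≤ 0 := by linarith [(abs_lt.1 hy).2]
  have : 0 ≤ p * -y := mul_nonneg hp0.le (by linarith)
  have : 0 ≤ p * (p + 1) / 2 * y ^ 2 := by positivity
  have : 0 ≤ 20 * |y| ^ 3 := by positivity
  linarith

theorem abs_one_add_rpow_neg_le_cubic {p y : ℝ} (hp0 : 0 < p) (hp1 : p ≤ 1)
    (hy : 1 / 2 ≤ |1 + y|) :
    |1 + y| ^ (-p) ≤ 1 - p * y + p * (p + 1) / 2 * y ^ 2 + 20 * |y| ^ 3 := by
  rcases le_or_gt |y| (1 / 2) with hy' | hy'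
  · rw [abs_of_pos (by linarith [neg_abs_le y])] at hy ⊢
    have := rpow_one_add_le_cubic (p := -p) (by rwa [abs_neg, abs_of_pos hp0]) hy'
    linarith
  · have h1 : |1 + y| ^ (-p) ≤ 2 := by
      calc |1 + y| ^ (-p) ≤ (1 / 2 : ℝ) ^ (-p) :=
            Real.rpow_le_rpow_of_nonpos (by norm_num) hy (by linarith)
        _ ≤ (1 / 2 : ℝ) ^ (-1 : ℝ) :=
            Real.rpow_le_rpow_of_exponent_ge (by norm_num) (by norm_num) (by linarith)
        _ = 2 := by rw [Real.rpow_neg_one]; norm_num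
    have h2 : p * y ≤ |y| := by nlinarith [le_abs_self y, abs_nonneg y]
    have h3 : 0 ≤ p * (p + 1) / 2 * y ^ 2 := by positivity
    have h4 : 5 * |y| ≤ 20 * |y| ^ 3 := by
      nlinarith [mul_nonneg (abs_nonneg y) (by nlinarith : 0 ≤ |y| ^ 2 - 1 / 4)]
    linarith

/-! ### One-step moments of the multiplier. -/

/-- The moment bound behind both one-step estimates. -/
theorem integral_cubic_le {Ω : Type*} [MeasurableSpace Ω] {P : Measure Ω} [IsProbabilityMeasure P]
    {ξ : Ω → ℝ} (h1 : Integrable ξ P) (h1' : ∫ ω, ξ ω ∂P = 0)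
    (h2 : Integrable (fun ω => ξ ω ^ 2) P) (h2' : ∫ ω, ξ ω ^ 2 ∂P = 1) {K : ℝ}
    (h3 : Integrable (fun ω => |ξ ω| ^ 3) P) (h3' : ∫ ω, |ξ ω| ^ 3 ∂P ≤ K)
    {a b : ℝ} (ha : 0 ≤ a) (hb : 0 ≤ b) (r s : ℝ) :
    Integrable (fun ω => 1 + r * (a + b * ξ ω) + s * (a + b * ξ ω) ^ 2
      + 20 * |a + b * ξ ω| ^ 3) P ∧
    ∫ ω, (1 + r * (a + b * ξ ω) + s * (a + b * ξ ω) ^ 2 + 20 * |a + b * ξ ω| ^ 3) ∂P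
      ≤ 1 + r * a + s * (a ^ 2 + b ^ 2) + 80 * (a ^ 3 + b ^ 3 * K) := by
  have hc : ∀ c : ℝ, Integrable (fun _ : Ω => c) P := fun c => integrable_const c
  -- `(u + v) ^ 3 ≤ 4 (u ^ 3 + v ^ 3)` turns the constant `20` into `80`.
  have hpoint : ∀ t : ℝ, |a + b * t| ^ 3 ≤ 4 * (a ^ 3 + b ^ 3 * |t| ^ 3) := by
    intro t
    have hbt : 0 ≤ b * |t| := by positivity
    have : |a + b * t| ≤ a + b * |t| :=
      (abs_add_le _ _).trans (by rw [abs_of_nonneg ha, abs_mul, abs_of_nonneg hb])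
    calc |a + b * t| ^ 3 ≤ (a + b * |t|) ^ 3 := by gcongr
      _ ≤ 4 * (a ^ 3 + (b * |t|) ^ 3) := by
        nlinarith [mul_nonneg (add_nonneg ha hbt) (sq_nonneg (a - b * |t|))]
      _ = _ := by ring
  have hlin : Integrable (fun ω => r * (a + b * ξ ω)) P := ((hc a).add (h1.const_mul b)).const_mul r
  have hquad : Integrable (fun ω => s * (a + b * ξ ω) ^ 2) P := by
    have : (fun ω => s * (a + b * ξ ω) ^ 2)
        = fun ω => s * a ^ 2 + (2 * s * a * b) * ξ ω + s * b ^ 2 * ξ ω ^ 2 := by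
      funext ω; ring
    rw [this]
    exact ((hc _).add (h1.const_mul _)).add (h2.const_mul _)
  have hdom : Integrable (fun ω => 20 * (4 * (a ^ 3 + b ^ 3 * |ξ ω| ^ 3))) P :=
    (((hc _).add (h3.const_mul _)).const_mul 4).const_mul 20
  have hcub : Integrable (fun ω => 20 * |a + b * ξ ω| ^ 3) P := by
    refine hdom.mono' ?_ (ae_of_all _ fun ω => ?_)
    · have := h1.aestronglyMeasurable
      have h := ((this.const_mul b).const_add a).norm.pow 3 |>.const_mul (20 : ℝ)
      exact h
    · rw [Real.norm_of_nonneg (by positivity)]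
      linarith [hpoint (ξ ω)]
  have hint := (((hc 1).add hlin).add hquad)
  have hi1 (A B : ℝ) : Integrable (fun ω => A + B * ξ ω) P := (hc A).add (h1.const_mul B)
  have hi2 (A B C : ℝ) : Integrable (fun ω => A + B * ξ ω + C * ξ ω ^ 2) P :=
    (hi1 A B).add (h2.const_mul C)
  refine ⟨hint.add hcub, ?_⟩
  calc _ ≤ ∫ ω, ((1 + r * a + s * a ^ 2 + 80 * a ^ 3) + (r * b + 2 * s * a * b) * ξ ω
        + s * b ^ 2 * ξ ω ^ 2 + 80 * b ^ 3 * |ξ ω| ^ 3) ∂P := by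
        refine integral_mono (hint.add hcub) ((hi2 _ _ _).add (h3.const_mul _)) fun ω => ?_
        have := hpoint (ξ ω)
        simp only
        nlinarith
    _ = (1 + r * a + s * a ^ 2 + 80 * a ^ 3) + (r * b + 2 * s * a * b) * 0
        + s * b ^ 2 * 1 + 80 * b ^ 3 * ∫ ω, |ξ ω| ^ 3 ∂P := by
        rw [integral_add (hi2 _ _ _) (h3.const_mul _),
          integral_add (hi1 _ _) (h2.const_mul _),
          integral_add (hc _) (h1.const_mul _), integral_const_mul, integral_const_mul,
          integral_const_mul, h1', h2']
        simp
    _ ≤ _ := by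
        have := mul_le_mul_of_nonneg_left h3' (pow_nonneg hb 3)
        linarith

theorem lintegral_enorm_rpow_neg_lt_top {q : ℝ} (hq1 : q < 1) :
    ∫⁻ z : ℝ in {z | |z| < 1 / 2}, ‖z‖ₑ ^ (-q) < ⊤ := by
  have hpos : ∫⁻ z : ℝ in Set.Ioo 0 (1 / 2), ‖z‖ₑ ^ (-q) < ⊤ := by
    have h : IntegrableOn (fun x : ℝ => x ^ (-q)) (Set.Ioo 0 (1 / 2)) := by
      rw [← intervalIntegrable_iff_integrableOn_Ioo_of_le (by norm_num)]
      exact intervalIntegral.intervalIntegrable_rpow' (by linarith)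
    refine lt_of_eq_of_lt (setLIntegral_congr_fun measurableSet_Ioo fun x hx => ?_) h.2
    simp only
    rw [← ofReal_norm, ← ofReal_norm, Real.norm_of_nonneg hx.1.le,
      Real.norm_of_nonneg (Real.rpow_nonneg hx.1.le _), ENNReal.ofReal_rpow_of_pos hx.1]
  have hneg : ∫⁻ z : ℝ in Set.Ioo (-(1 / 2)) 0, ‖z‖ₑ ^ (-q) < ⊤ := by
    have h := (Measure.measurePreserving_neg (volume : Measure ℝ)).setLIntegral_comp_preimage_emb
      (MeasurableEquiv.neg ℝ).measurableEmbedding (fun z => ‖z‖ₑ ^ (-q)) (Set.Ioo 0 (1 / 2))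
    simp only [enorm_neg, Set.neg_preimage, Set.neg_Ioo, neg_zero] at h
    rwa [h]
  have hsub : {z : ℝ | |z| < 1 / 2} ⊆ (Set.Ioo (-(1 / 2)) 0 ∪ Set.Ioo 0 (1 / 2)) ∪ {0} := by
    intro z hz
    have hz' := abs_lt.1 (show |z| < 1 / 2 from hz)
    rcases lt_trichotomy z 0 with h | h | h
    · exact Or.inl (Or.inl ⟨hz'.1, h⟩)
    · exact Or.inr h
    · exact Or.inl (Or.inr ⟨h, hz'.2⟩)
  calc _ ≤ _ := lintegral_mono_set hsub
    _ ≤ _ := lintegral_union_le _ _ _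
    _ ≤ _ := add_le_add_left (lintegral_union_le _ _ _) _
    _ < ⊤ := by
      rw [setLIntegral_measure_zero {0} _ (by simp)]
      exact ENNReal.add_lt_top.2 ⟨ENNReal.add_lt_top.2 ⟨hneg, hpos⟩, ENNReal.zero_lt_top⟩

theorem lintegral_comp_add_mul {H : ℝ → ENNReal} (hH : Measurable H) (c : ℝ) {b : ℝ}
    (hb : 0 < b) : ∫⁻ x, H (c + b * x) = ENNReal.ofReal b⁻¹ * ∫⁻ z, H z := by
  have h := lintegral_map (μ := (volume : Measure ℝ)) (f := fun z => H (c + z))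
    (g := fun x => b * x) (by fun_prop) (by fun_prop)
  rw [← h, Real.map_volume_mul_left hb.ne', lintegral_smul_measure, lintegral_add_left_eq_self H,
    abs_of_pos (inv_pos.2 hb), smul_eq_mul]

/-- Near the singularity `b |x| ≥ 1 / 2`, so the tail hypothesis gives `p x ≤ 8 ε b ^ 3`. The
substitution `z = 1 + a + b x` returns a factor `1 / b`, leaving the order `b ^ 2` of the drift. -/
theorem lintegral_singular_part_le {p : ℝ → ℝ} (hp : Measurable p) (hp0 : ∀ x, 0 ≤ p x)
    {ε R : ℝ} (hR : ∀ x, R ≤ |x| → |x ^ 3 * p x| ≤ ε) (q : ℝ) {a b : ℝ} (ha : 0 ≤ a) (hb : 0 < b)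
    (hbR : R * (2 * b) ≤ 1) :
    ∫⁻ x, {z : ℝ | |z| < 1 / 2}.indicator (fun z => ‖z‖ₑ ^ (-q)) (1 + (a + b * x))
        ∂(volume.withDensity fun x => ENNReal.ofReal (p x))
      ≤ ENNReal.ofReal (8 * ε * b ^ 2) * ∫⁻ z : ℝ in {z | |z| < 1 / 2}, ‖z‖ₑ ^ (-q) := by
  have hS : MeasurableSet {z : ℝ | |z| < 1 / 2} := measurableSet_lt (by fun_prop) (by fun_prop)
  set H : ℝ → ENNReal := {z : ℝ | |z| < 1 / 2}.indicator (fun z => ‖z‖ₑ ^ (-q)) with hHdef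
  have hH : Measurable H := Measurable.indicator (by fun_prop) hS
  have hε : 0 ≤ ε := (abs_nonneg _).trans (hR (max R 0) ((le_max_left _ _).trans (le_abs_self _)))
  rw [lintegral_withDensity_eq_lintegral_mul _ (by fun_prop) (by fun_prop)]
  calc _ ≤ ∫⁻ x, ENNReal.ofReal (8 * ε * b ^ 3) * H ((1 + a) + b * x) := by
        refine lintegral_mono fun x => ?_
        simp only [Pi.mul_apply, ← add_assoc]
        by_cases hx : |1 + a + b * x| < 1 / 2
        · gcongr
          have h1 : 1 / 2 ≤ b * |x| := by
            rw [show b * |x| = |b * x| by rw [abs_mul, abs_of_pos hb], le_abs]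
            right
            linarith [(abs_lt.1 hx).2]
          have h2 : R ≤ |x| := by
            rcases le_or_gt R 0 with h | h
            · exact h.trans (abs_nonneg x)
            · nlinarith
          have h3 := hR x h2
          rw [abs_mul, abs_of_nonneg (hp0 x), abs_pow] at h3
          have h4 : (1 / 2 : ℝ) ^ 3 ≤ (b * |x|) ^ 3 := by gcongr
          calc p x = 8 * ((1 / 2 : ℝ) ^ 3 * p x) := by ring
            _ ≤ 8 * ((b * |x|) ^ 3 * p x) := by
              have := mul_le_mul_of_nonneg_right h4 (hp0 x)
              linarith
            _ = 8 * b ^ 3 * (|x| ^ 3 * p x) := by ring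
            _ ≤ 8 * b ^ 3 * ε := by gcongr
            _ = _ := by ring
        · have : H (1 + a + b * x) = 0 := Set.indicator_of_notMem (by simpa using hx) _
          simp [this]
    _ = ENNReal.ofReal (8 * ε * b ^ 3) * (ENNReal.ofReal b⁻¹ * ∫⁻ z, H z) := by
        rw [lintegral_const_mul _ (by fun_prop), lintegral_comp_add_mul hH _ hb]
    _ = _ := by
        rw [← mul_assoc, ← ENNReal.ofReal_mul (by positivity), hHdef, lintegral_indicator hS]
        congr 2
        field_simp

section OneStep

variable {Ω : Type*} [MeasurableSpace Ω] {P : Measure Ω} [IsProbabilityMeasure P] {ξ : Ω → ℝ}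

theorem lintegral_enorm_rpow_le (h1 : Integrable ξ P) (h1' : ∫ ω, ξ ω ∂P = 0)
    (h2 : Integrable (fun ω => ξ ω ^ 2) P) (h2' : ∫ ω, ξ ω ^ 2 ∂P = 1) {K : ℝ}
    (h3 : Integrable (fun ω => |ξ ω| ^ 3) P) (h3' : ∫ ω, |ξ ω| ^ 3 ∂P ≤ K)
    {a b q : ℝ} (ha : 0 ≤ a) (hb : 0 ≤ b) (hq0 : 0 < q) (hq1 : q ≤ 1) :
    ∫⁻ ω, ‖1 + (a + b * ξ ω)‖ₑ ^ q ∂P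
      ≤ ENNReal.ofReal (1 + q * a + q * (q - 1) / 2 * (a ^ 2 + b ^ 2)
        + 80 * (a ^ 3 + b ^ 3 * K)) := by
  obtain ⟨hi, hle⟩ := integral_cubic_le h1 h1' h2 h2' h3 h3' ha hb q (q * (q - 1) / 2)
  have hpt (y : ℝ) := abs_one_add_rpow_le_cubic hq0 hq1 y
  refine le_trans ?_ (ENNReal.ofReal_le_ofReal hle)
  rw [ofReal_integral_eq_lintegral_ofReal hi
    (ae_of_all _ fun ω => (Real.rpow_nonneg (abs_nonneg _) _).trans (hpt _))]
  refine lintegral_mono fun ω => ?_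
  rw [← ofReal_norm, ENNReal.ofReal_rpow_of_nonneg (norm_nonneg _) hq0.le]
  exact ENNReal.ofReal_le_ofReal (hpt _)

/-- The integrand is below the cubic majorant where `|1 + y| ≥ 1 / 2`. Elsewhere it equals the
singular part `H`, and the majorant is still nonnegative, so their sum dominates everywhere. -/
theorem lintegral_enorm_rpow_neg_le (hξ : Measurable ξ)
    (h1 : Integrable ξ P) (h1' : ∫ ω, ξ ω ∂P = 0)
    (h2 : Integrable (fun ω => ξ ω ^ 2) P) (h2' : ∫ ω, ξ ω ^ 2 ∂P = 1) {K : ℝ}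
    (h3 : Integrable (fun ω => |ξ ω| ^ 3) P) (h3' : ∫ ω, |ξ ω| ^ 3 ∂P ≤ K)
    {p : ℝ → ℝ} (hp : Measurable p) (hp0 : ∀ x, 0 ≤ p x)
    (hlaw : P.map ξ = volume.withDensity fun x => ENNReal.ofReal (p x))
    {ε R : ℝ} (hR : ∀ x, R ≤ |x| → |x ^ 3 * p x| ≤ ε)
    {a b q : ℝ} (ha : 0 ≤ a) (hb : 0 ≤ b) (hq0 : 0 < q) (hq1 : q < 1) (hbR : R * (2 * b) ≤ 1) :
    ∫⁻ ω, ‖1 + (a + b * ξ ω)‖ₑ ^ (-q) ∂P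
      ≤ ENNReal.ofReal (1 - q * a + q * (q + 1) / 2 * (a ^ 2 + b ^ 2) + 80 * (a ^ 3 + b ^ 3 * K)
        + 8 * ε * (∫⁻ z : ℝ in {z | |z| < 1 / 2}, ‖z‖ₑ ^ (-q)).toReal * b ^ 2) := by
  have hS : MeasurableSet {z : ℝ | |z| < 1 / 2} := measurableSet_lt (by fun_prop) (by fun_prop)
  have hε : 0 ≤ ε := (abs_nonneg _).trans (hR (max R 0) ((le_max_left _ _).trans (le_abs_self _)))
  set C := ∫⁻ z : ℝ in {z | |z| < 1 / 2}, ‖z‖ₑ ^ (-q) with hC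
  have hCtop : C ≠ ⊤ := (lintegral_enorm_rpow_neg_lt_top hq1).ne
  set H : ℝ → ENNReal := {z : ℝ | |z| < 1 / 2}.indicator (fun z => ‖z‖ₑ ^ (-q)) with hHdef
  have hH : Measurable H := Measurable.indicator (by fun_prop) hS
  have hsing : ∫⁻ ω, H (1 + (a + b * ξ ω)) ∂P ≤ ENNReal.ofReal (8 * ε * C.toReal * b ^ 2) := by
    -- The change of variables needs `b > 0`; for `b = 0` the multiplier is `1 + a ≥ 1`, off the
    -- singular set.
    rcases hb.eq_or_lt with rfl | hb'
    · have : H (1 + a) = 0 := Set.indicator_of_notMem (by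
        simp only [Set.mem_ofPred_eq, not_lt]
        rw [abs_of_nonneg (by linarith)]
        linarith) _
      simp [this]
    · rw [← lintegral_map (f := fun x => H (1 + (a + b * x))) (by fun_prop) hξ, hlaw]
      refine (lintegral_singular_part_le hp hp0 hR q ha hb' hbR).trans (le_of_eq ?_)
      rw [← hC, ← ENNReal.ofReal_toReal hCtop, ← ENNReal.ofReal_mul (by positivity),
        ENNReal.toReal_ofReal ENNReal.toReal_nonneg]
      congr 1
      ring
  obtain ⟨hi, hle⟩ := integral_cubic_le h1 h1' h2 h2' h3 h3' ha hb (-q) (q * (q + 1) / 2)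
  have hnn (y : ℝ) : 0 ≤ 1 + -q * y + q * (q + 1) / 2 * y ^ 2 + 20 * |y| ^ 3 := by
    rcases le_or_gt (1 / 2) |1 + y| with h | h
    · have := abs_one_add_rpow_neg_le_cubic hq0 hq1.le h
      have := Real.rpow_nonneg (abs_nonneg (1 + y)) (-q)
      linarith
    · have := cubic_nonneg_of_near_neg_one hq0 h
      linarith
  have hle0 := (integral_nonneg fun ω => hnn (a + b * ξ ω)).trans hle
  have e : 1 - q * a + q * (q + 1) / 2 * (a ^ 2 + b ^ 2) + 80 * (a ^ 3 + b ^ 3 * K)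
      = 1 + -q * a + q * (q + 1) / 2 * (a ^ 2 + b ^ 2) + 80 * (a ^ 3 + b ^ 3 * K) := by ring
  rw [e, ENNReal.ofReal_add hle0 (by positivity)]
  refine le_trans ?_ (add_le_add (ENNReal.ofReal_le_ofReal hle) hsing)
  rw [ofReal_integral_eq_lintegral_ofReal hi (ae_of_all _ fun ω => hnn _),
    ← lintegral_add_right _ (by fun_prop)]
  refine lintegral_mono fun ω => ?_
  set y := a + b * ξ ω
  simp only
  by_cases h : |1 + y| < 1 / 2
  · have : H (1 + y) = ‖1 + y‖ₑ ^ (-q) := Set.indicator_of_mem (by simpa using h) _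
    rw [this]
    exact le_add_self
  · have hy := abs_one_add_rpow_neg_le_cubic hq0 hq1.le (not_lt.1 h)
    refine le_add_right ?_
    rw [← ofReal_norm,
      ENNReal.ofReal_rpow_of_pos (by rw [Real.norm_eq_abs]; linarith [not_lt.1 h])]
    refine ENNReal.ofReal_le_ofReal ?_
    rw [Real.norm_eq_abs]
    linarith

end OneStep

/-- Freezing lemma: a bound on `∫ F (x, ξ)` for each fixed state `x` passes to a random state
independent of `ξ`, on events that are also independent of `ξ`. -/
theorem setLIntegral_le_of_indep {Ω : Type*} {m mΩ : MeasurableSpace Ω} {P : Measure Ω}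
    [IsProbabilityMeasure P] (hm : m ≤ mΩ) {X ξ : Ω → ℝ} (hX : Measurable[m] X)
    (hξ : Measurable ξ) (hind : Indep (MeasurableSpace.comap ξ inferInstance) m P)
    {A : Set Ω} (hA : MeasurableSet[m] A) {F : ℝ → ℝ → ENNReal}
    (hF : Measurable (Function.uncurry F)) {c : ℝ → ENNReal}
    (hle : ∀ ω ∈ A, ∫⁻ ω', F (X ω) (ξ ω') ∂P ≤ c (X ω)) :
    ∫⁻ ω in A, F (X ω) (ξ ω) ∂P ≤ ∫⁻ ω in A, c (X ω) ∂P := by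
  have hA' := hm _ hA
  set I : Ω → ENNReal := A.indicator (fun _ => 1) with hI
  have hIm : Measurable[m] I :=
    Measurable.indicator measurable_const hA
  -- The indicator of `A` travels with the state, so that one product law covers both.
  have hZ : Measurable[m] fun ω => (I ω, X ω) := hIm.prodMk hX
  have hZ' : Measurable fun ω => (I ω, X ω) := hZ.mono hm le_rfl
  have hindep : IndepFun (fun ω => (I ω, X ω)) ξ P := by
    rw [IndepFun_iff_Indep]
    exact indep_of_indep_of_le_left hind.symm hZ.comap_le
  have hprod := (indepFun_iff_map_prod_eq_prod_map_map hZ'.aemeasurable hξ.aemeasurable).1 hindep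
  have hG : Measurable fun z : (ENNReal × ℝ) × ℝ => z.1.1 * F z.1.2 z.2 := by
    have : Measurable fun z : (ENNReal × ℝ) × ℝ => F z.1.2 z.2 :=
      hF.comp (g := Function.uncurry F) (f := fun z : (ENNReal × ℝ) × ℝ => (z.1.2, z.2))
        (by fun_prop)
    fun_prop
  calc ∫⁻ ω in A, F (X ω) (ξ ω) ∂P = ∫⁻ ω, I ω * F (X ω) (ξ ω) ∂P := by
        rw [← lintegral_indicator hA']
        refine lintegral_congr fun ω => ?_
        by_cases h : ω ∈ A <;> simp [hI, h]
    _ = ∫⁻ z, z.1.1 * F z.1.2 z.2 ∂(P.map fun ω => ((I ω, X ω), ξ ω)) := by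
        rw [lintegral_map hG (hZ'.prodMk hξ)]
    _ = ∫⁻ ω, I ω * ∫⁻ ω', F (X ω) (ξ ω') ∂P ∂P := by
        rw [hprod, lintegral_prod _ hG.aemeasurable,
          lintegral_map (Measurable.lintegral_prod_right' hG) hZ']
        refine lintegral_congr fun ω => ?_
        have hFx : Measurable (F (X ω)) := hF.of_uncurry_left
        rw [lintegral_map (f := fun y => I ω * F (X ω) y) (by fun_prop) hξ,
          lintegral_const_mul _ (by fun_prop)]
    _ ≤ ∫⁻ ω, A.indicator (fun ω => c (X ω)) ω ∂P := by
        refine lintegral_mono fun ω => ?_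
        by_cases h : ω ∈ A
        · simpa [hI, h] using hle ω h
        · simp [hI, h]
    _ = _ := lintegral_indicator hA' _

/-! ### Drift and noise amplitudes under the adaptive step. -/

section Coefficients

variable {f g : ℝ → ℝ} {hbar : ℝ}

theorem IsCoefficientPair.adaptiveStep_nonneg (hfg : IsCoefficientPair f g) (hh : 0 ≤ hbar)
    (x : ℝ) : 0 ≤ adaptiveStep f g hbar x := by
  have := hfg.f_nonneg x
  unfold adaptiveStep
  positivity

theorem IsCoefficientPair.measurable_adaptiveStep (hfg : IsCoefficientPair f g) :
    Measurable (adaptiveStep f g hbar) := by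
  have := hfg.measurable_f
  have := hfg.measurable_g
  unfold adaptiveStep
  fun_prop

theorem IsCoefficientPair.step_mul_f_le (hfg : IsCoefficientPair f g) (hh : 0 ≤ hbar) (x : ℝ) :
    adaptiveStep f g hbar x * f x ≤ hbar := by
  have hf := hfg.f_nonneg x
  have : 0 < 1 + f x + g x ^ 2 := by positivity
  rw [adaptiveStep, div_mul_eq_mul_div, div_le_iff₀ this]
  exact mul_le_mul_of_nonneg_left (by nlinarith [sq_nonneg (g x)]) hh

theorem IsCoefficientPair.sq_sqrt_step_mul_g (hfg : IsCoefficientPair f g) (hh : 0 ≤ hbar) (x : ℝ) :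
    (√(adaptiveStep f g hbar x) * g x) ^ 2 = adaptiveStep f g hbar x * g x ^ 2 := by
  rw [mul_pow, Real.sq_sqrt (hfg.adaptiveStep_nonneg hh x)]

theorem IsCoefficientPair.sqrt_step_mul_g_le (hfg : IsCoefficientPair f g) (hh : 0 ≤ hbar)
    {η : ℝ} (hη : 0 ≤ η) (hhη : hbar ≤ η ^ 2) (x : ℝ) :
    √(adaptiveStep f g hbar x) * g x ≤ η := by
  have hf := hfg.f_nonneg x
  have hd : 0 < 1 + f x + g x ^ 2 := by positivity
  refine le_of_sq_le_sq ?_ hη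
  rw [hfg.sq_sqrt_step_mul_g hh, adaptiveStep, div_mul_eq_mul_div, div_le_iff₀ hd]
  have : hbar * g x ^ 2 ≤ hbar * (1 + f x + g x ^ 2) :=
    mul_le_mul_of_nonneg_left (by linarith) hh
  exact this.trans (mul_le_mul_of_nonneg_right hhη hd.le)

end Coefficients

section Solution

theorem IsAdaptiveSolution.step' {Ω : Type*} {f g : ℝ → ℝ} {hbar : ℝ} {χ : ℕ → Ω → ℝ}
    {ς : ℝ} {X : ℕ → Ω → ℝ} (hX : IsAdaptiveSolution f g hbar χ ς X) (n : ℕ) (ω : Ω) :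
    X (n + 1) ω = X n ω * (1 + (adaptiveStep f g hbar (X n ω) * f (X n ω)
      + √(adaptiveStep f g hbar (X n ω)) * g (X n ω) * χ (n + 1) ω)) := by
  rw [hX.step, add_assoc]

variable {Ω : Type*} [MeasurableSpace Ω] {P : Measure Ω} {f g : ℝ → ℝ} {hbar : ℝ}
  {χ : ℕ → Ω → ℝ} {ς : ℝ} {X : ℕ → Ω → ℝ}

/-- The filtration generated by the noise. -/
noncomputable def IsNoise.filtration (hχ : IsNoise P χ) : Filtration ℕ ‹MeasurableSpace Ω› :=
  Filtration.natural χ fun n => (hχ.measurable n).stronglyMeasurable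

theorem IsNoise.indep_filtration (hχ : IsNoise P χ) (n : ℕ) :
    Indep (MeasurableSpace.comap (χ (n + 1)) inferInstance) (hχ.filtration n) P :=
  hχ.indep.indep_comap_natural_of_lt (fun n => (hχ.measurable n).stronglyMeasurable)
    n.lt_succ_self

theorem IsAdaptiveSolution.measurable (hX : IsAdaptiveSolution f g hbar χ ς X)
    (hfg : IsCoefficientPair f g) (hχ : IsNoise P χ) (n : ℕ) :
    Measurable[hχ.filtration n] (X n) := by
  have := hfg.measurable_f
  have := hfg.measurable_g
  have := hfg.measurable_adaptiveStep (hbar := hbar)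
  induction n with
  | zero =>
    rw [show X 0 = fun _ => ς from funext hX.init]
    exact measurable_const
  | succ n ih =>
    have h1 : Measurable[hχ.filtration (n + 1)] (X n) :=
      ih.mono (hχ.filtration.mono n.le_succ) le_rfl
    have h2 : Measurable[hχ.filtration (n + 1)] (χ (n + 1)) :=
      (Filtration.stronglyAdapted_natural
        fun n => (hχ.measurable n).stronglyMeasurable) (n + 1) |>.measurable
    have hΦ : Measurable fun z : ℝ × ℝ => z.1 * (1 + (adaptiveStep f g hbar z.1 * f z.1
      + √(adaptiveStep f g hbar z.1) * g z.1 * z.2)) := by fun_prop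
    rw [funext (hX.step' n)]
    exact hΦ.comp (h1.prodMk h2)

/-- One step of a Lyapunov function `u + D`: a bound for frozen states transfers to the solution. -/
theorem IsAdaptiveSolution.setLIntegral_rpow_succ_le [IsProbabilityMeasure P]
    (hX : IsAdaptiveSolution f g hbar χ ς X) (hfg : IsCoefficientPair f g) (hχ : IsNoise P χ)
    (n : ℕ) (r : ℝ) {A : Set Ω} (hA : MeasurableSet[hχ.filtration n] A) {D c : ℝ → ENNReal}
    (hD : Measurable D)
    (hle : ∀ ω ∈ A, ‖X n ω‖ₑ ^ r * ∫⁻ ω', ‖1 + (adaptiveStep f g hbar (X n ω) * f (X n ω)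
      + √(adaptiveStep f g hbar (X n ω)) * g (X n ω) * χ (n + 1) ω')‖ₑ ^ r ∂P + D (X n ω)
        ≤ c (X n ω)) :
    ∫⁻ ω in A, (‖X (n + 1) ω‖ₑ ^ r + D (X n ω)) ∂P ≤ ∫⁻ ω in A, c (X n ω) ∂P := by
  have := hfg.measurable_f
  have := hfg.measurable_g
  have := hfg.measurable_adaptiveStep (hbar := hbar)
  have hχm := hχ.measurable (n + 1)
  have key := setLIntegral_le_of_indep (hχ.filtration.le n) (hX.measurable hfg hχ n) hχm
    (hχ.indep_filtration n) hA (c := c)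
    (F := fun x y => ‖x * (1 + (adaptiveStep f g hbar x * f x
      + √(adaptiveStep f g hbar x) * g x * y))‖ₑ ^ r + D x)
    (by unfold Function.uncurry; fun_prop) (fun ω hω => ?_)
  · simpa only [← hX.step'] using key
  · rw [lintegral_add_right _ measurable_const, lintegral_const, measure_univ, mul_one]
    simp_rw [enorm_mul, ENNReal.mul_rpow_of_ne_top enorm_ne_top enorm_ne_top]
    rw [lintegral_const_mul _ (by fun_prop)]
    exact hle ω hω

end Solution

/-! ### Stability. -/

/-- Coefficient arithmetic: small steps contract the `q`-th moment when `a ≤ β / 2 * b ^ 2`. -/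
theorem one_step_stable {β K η a b q : ℝ} (hβ0 : 0 ≤ β) (hβ : β < 1) (hq : q = (1 - β) / 2)
    (hK : 0 ≤ K) (hη1 : η ≤ 1) (hη : η * (40 + 80 * K) ≤ q ^ 2 / 4)
    (ha : 0 ≤ a) (hb : 0 ≤ b) (haη : a ≤ η ^ 2) (hbη : b ≤ η) (hab : a ≤ β / 2 * b ^ 2) :
    1 + q * a + q * (q - 1) / 2 * (a ^ 2 + b ^ 2) + 80 * (a ^ 3 + b ^ 3 * K)
      + q ^ 2 / 4 * b ^ 2 ≤ 1 := by
  have hη0 : 0 ≤ η := hb.trans hbη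
  have hβq : β = 1 - 2 * q := by linarith
  have hq0 : 0 < q := by linarith
  have h1 : q * a ≤ q * (β / 2 * b ^ 2) := mul_le_mul_of_nonneg_left hab hq0.le
  have h2 : q * (q - 1) / 2 * a ^ 2 ≤ 0 :=
    mul_nonpos_of_nonpos_of_nonneg (by nlinarith) (sq_nonneg a)
  have haη' : a ≤ η := haη.trans (by nlinarith)
  have ha1 : a ≤ 1 := haη'.trans hη1
  have hab' : a ≤ 1 / 2 * b ^ 2 := hab.trans (by nlinarith [sq_nonneg b])
  have h3 : a ^ 3 ≤ η * (1 / 2 * b ^ 2) := by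
    calc a ^ 3 = a * a * a := by ring
      _ ≤ 1 * η * (1 / 2 * b ^ 2) := by gcongr
      _ = _ := by ring
  have h4 : b ^ 3 * K ≤ η * K * b ^ 2 := by
    have : b * (b ^ 2 * K) ≤ η * (b ^ 2 * K) := by gcongr
    linarith
  have h5 := mul_le_mul_of_nonneg_right hη (sq_nonneg b)
  rw [hβq] at h1
  nlinarith

theorem IsCoefficientPair.f_le_of_isLUB {f g : ℝ → ℝ} (hfg : IsCoefficientPair f g) {β : ℝ}
    (hβ : β ∈ upperBounds ((fun u : ℝ => 2 * f u / g u ^ 2) '' {u | u ≠ 0})) {u : ℝ} (hu : u ≠ 0) :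
    f u ≤ β / 2 * g u ^ 2 := by
  have h : 2 * f u / g u ^ 2 ≤ β := hβ ⟨u, hu, rfl⟩
  have : 0 < g u ^ 2 := pow_pos ((hfg.g_nonneg u).lt_of_ne' (hfg.g_ne_zero u hu)) 2
  rw [div_le_iff₀ this] at h
  linarith

section Stability

variable {Ω : Type*} [MeasurableSpace Ω] {P : Measure Ω} [IsProbabilityMeasure P] {f g : ℝ → ℝ}
  {hbar : ℝ} {χ : ℕ → Ω → ℝ} {ς : ℝ} {X : ℕ → Ω → ℝ}

/-- If `‖X n‖ ^ q` loses `D (X n)` in conditional mean at each step, then almost surely it converges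
and `D (X n) → 0`. -/
theorem IsAdaptiveSolution.ae_tendsto_of_dissipation (hX : IsAdaptiveSolution f g hbar χ ς X)
    (hfg : IsCoefficientPair f g) (hχ : IsNoise P χ) {q : ℝ} (hq : 0 < q) {D : ℝ → ENNReal}
    (hD : Measurable D)
    (hle : ∀ n x, ‖x‖ₑ ^ q * ∫⁻ ω', ‖1 + (adaptiveStep f g hbar x * f x
      + √(adaptiveStep f g hbar x) * g x * χ (n + 1) ω')‖ₑ ^ q ∂P + D x ≤ ‖x‖ₑ ^ q) :
    ∀ᵐ ω ∂P, (∃ c, Tendsto (fun n => |X n ω| ^ q) atTop (𝓝 c)) ∧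
      Tendsto (fun n => D (X n ω)) atTop (𝓝 0) := by
  have hXm' := hX.measurable hfg hχ
  have hXm n : Measurable (X n) := (hXm' n).mono (hχ.filtration.le n) le_rfl
  have hstep (n : ℕ) (A : Set Ω) (hA : MeasurableSet[hχ.filtration n] A) :
      ∫⁻ ω in A, ‖X (n + 1) ω‖ₑ ^ q ∂P + ∫⁻ ω in A, D (X n ω) ∂P ≤ ∫⁻ ω in A, ‖X n ω‖ₑ ^ q ∂P := by
    have := hX.setLIntegral_rpow_succ_le hfg hχ n q hA hD (c := fun x => ‖x‖ₑ ^ q)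
      fun ω _ => hle n (X n ω)
    rwa [lintegral_add_left (by have := hXm (n + 1); fun_prop)] at this
  have hsum (N : ℕ) : ∑ n ∈ Finset.range N, ∫⁻ ω, D (X n ω) ∂P + ∫⁻ ω, ‖X N ω‖ₑ ^ q ∂P
      ≤ ‖ς‖ₑ ^ q := by
    induction N with
    | zero => simp [hX.init]
    | succ N ih =>
      refine le_trans ?_ ih
      have := hstep N Set.univ MeasurableSet.univ
      simp only [Measure.restrict_univ] at this
      rw [Finset.sum_range_succ, add_assoc]
      gcongr
      rwa [add_comm]
  have hς : ‖ς‖ₑ ^ q ≠ ⊤ := ENNReal.rpow_ne_top_of_nonneg hq.le enorm_ne_top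
  have hbound (N : ℕ) : ∫⁻ ω, ‖X N ω‖ₑ ^ q ∂P ≤ ‖ς‖ₑ ^ q := le_add_self.trans (hsum N)
  have henorm (N : ℕ) (ω : Ω) : ‖|X N ω| ^ q‖ₑ = ‖X N ω‖ₑ ^ q := by
    rw [← ofReal_norm, ← ofReal_norm, Real.norm_of_nonneg (by positivity),
      ENNReal.ofReal_rpow_of_nonneg (norm_nonneg _) hq.le, Real.norm_eq_abs]
  have hint (N : ℕ) : Integrable (fun ω => |X N ω| ^ q) P := by
    refine ⟨?_, ?_⟩
    · have := hXm N
      exact Measurable.aestronglyMeasurable (by fun_prop)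
    · simp only [HasFiniteIntegral, henorm]
      exact (hbound N).trans_lt hς.lt_top
  have hsuper : Supermartingale (fun n ω => |X n ω| ^ q) hχ.filtration P := by
    -- Integrals over events of the filtration suffice, so no conditional expectation is computed.
    refine supermartingale_of_setIntegral_succ_le (fun n => ?_) hint fun n A hA => ?_
    · have h : Measurable fun x : ℝ => |x| ^ q := by fun_prop
      exact (h.comp (hXm' n)).stronglyMeasurable
    · have e (k : ℕ) : ∫ ω in A, |X k ω| ^ q ∂P = (∫⁻ ω in A, ‖X k ω‖ₑ ^ q ∂P).toReal := by
        rw [integral_eq_lintegral_of_nonneg_ae (ae_of_all _ fun ω => by positivity)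
          (hint k).aestronglyMeasurable.restrict]
        congr 1
        refine lintegral_congr fun ω => ?_
        rw [← henorm, Real.enorm_of_nonneg (by positivity)]
      rw [e, e]
      exact ENNReal.toReal_mono (((setLIntegral_le_lintegral _ _).trans (hbound n)).trans_lt
        hς.lt_top).ne (le_self_add.trans (hstep n A hA))
  have hconv := hsuper.neg.exists_ae_tendsto_of_bdd (R := (‖ς‖ₑ ^ q).toNNReal) fun n => by
    rw [eLpNorm_one_eq_lintegral_enorm, ENNReal.coe_toNNReal hς]
    simpa [henorm] using hbound n
  have hDm (n : ℕ) : AEMeasurable (fun ω => D (X n ω)) P := (hD.comp (hXm n)).aemeasurable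
  have htsum : ∫⁻ ω, ∑' n, D (X n ω) ∂P ≠ ⊤ := by
    rw [lintegral_tsum hDm]
    refine ne_top_of_le_ne_top hς (ENNReal.tsum_le_of_sum_range_le fun N => ?_)
    exact le_self_add.trans (hsum N)
  filter_upwards [hconv, ae_lt_top' (AEMeasurable.tsum hDm) htsum] with ω ⟨c, hc⟩ hω
  exact ⟨⟨-c, by simpa using hc.neg⟩, ENNReal.tendsto_atTop_zero_of_tsum_ne_top hω.ne⟩

/-- A dissipation that is bounded below off `0` forces the limit to be `0`. -/
theorem tendsto_zero_of_dissipation {x : ℕ → ℝ} {q c : ℝ} (hq : 0 < q)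
    (hc : Tendsto (fun n => |x n| ^ q) atTop (𝓝 c)) {G : ℝ → ℝ} (hG : ContinuousOn G {0}ᶜ)
    (hG0 : ∀ u, u ≠ 0 → 0 < G u)
    (hD : Tendsto (fun n => ENNReal.ofReal (G (x n))) atTop (𝓝 0)) :
    Tendsto x atTop (𝓝 0) := by
  have habs : Tendsto (fun n => |x n|) atTop (𝓝 (c ^ q⁻¹)) := by
    refine (hc.rpow_const (p := q⁻¹) (Or.inr (by positivity))).congr fun n => ?_
    rw [← Real.rpow_mul (abs_nonneg _), mul_inv_cancel₀ hq.ne', Real.rpow_one]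
  set l := c ^ q⁻¹
  have hl0 : 0 ≤ l := ge_of_tendsto' habs fun n => abs_nonneg _
  rcases hl0.eq_or_lt with hl | hl
  · rw [← hl] at habs
    exact (tendsto_zero_iff_abs_tendsto_zero _).2 habs
  exfalso
  -- If the limit `l` of `|x n|` is positive, the sequence ends in this compact annulus, where `G`
  -- has a positive minimum.
  set S : Set ℝ := Metric.closedBall 0 (2 * l) ∩ {u | l / 2 ≤ |u|} with hS
  have hSc : IsCompact S := (isCompact_closedBall _ _).inter_right
    (isClosed_le continuous_const continuous_abs)
  have hS0 : S ⊆ {0}ᶜ := by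
    rintro u ⟨-, hu⟩ rfl
    simp only [Set.mem_ofPred_eq, abs_zero] at hu
    linarith
  have hlS : l ∈ S := by
    constructor
    · rw [mem_closedBall_zero_iff, Real.norm_of_nonneg hl0]; linarith
    · simp only [Set.mem_ofPred_eq, abs_of_pos hl]; linarith
  obtain ⟨u, huS, hu⟩ := hSc.exists_isMinOn ⟨l, hlS⟩ (hG.mono hS0)
  have hGu : 0 < ENNReal.ofReal (G u) := ENNReal.ofReal_pos.2 (hG0 u (hS0 huS))
  have e1 := hD.eventually (gt_mem_nhds hGu)
  have e2 := habs.eventually (Ioo_mem_nhds (show l / 2 < l by linarith)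
    (show l < 2 * l by linarith))
  obtain ⟨n, h1, h2⟩ := (e1.and e2).exists
  have hxS : x n ∈ S := ⟨by rw [mem_closedBall_zero_iff, Real.norm_eq_abs]; exact h2.2.le, h2.1.le⟩
  exact absurd h1 (not_lt.2 (ENNReal.ofReal_le_ofReal (hu hxS)))

theorem exists_step_bound_tendsto_zero (hfg : IsCoefficientPair f g) (hχ : IsNoise P χ)
    (hf : ContinuousOn f {0}ᶜ) (hg : ContinuousOn g {0}ᶜ) {β : ℝ} (hβ1 : β < 1)
    (hβ : IsLUB ((fun u : ℝ => 2 * f u / g u ^ 2) '' {u | u ≠ 0}) β) :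
    ∃ h₀ : ℝ, 0 < h₀ ∧ ∀ hbar : ℝ, 0 < hbar → hbar ≤ h₀ → ∀ ς : ℝ, 0 < ς →
      ∀ X : ℕ → Ω → ℝ, IsAdaptiveSolution f g hbar χ ς X →
        ∀ᵐ ω ∂P, Tendsto (fun n => X n ω) atTop (𝓝 0) := by
  obtain ⟨K, hK⟩ := hχ.third_moment
  have hK0 : 0 ≤ K := (integral_nonneg fun ω => by positivity).trans (hK 0).2
  -- The supremum is at least the nonnegative ratio at `1`; this keeps `q ≤ 1`.
  have hβ0 : 0 ≤ β := by
    refine le_trans ?_ (hβ.1 ⟨1, one_ne_zero, rfl⟩)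
    have := hfg.f_nonneg 1
    positivity
  set q := (1 - β) / 2 with hq
  have hq0 : 0 < q := by linarith
  have hq1 : q ≤ 1 := by linarith
  set η := min 1 (q ^ 2 / 4 / (40 + 80 * K)) with hηdef
  have hη0 : 0 < η := by positivity
  have hη1 : η ≤ 1 := min_le_left _ _
  have hη : η * (40 + 80 * K) ≤ q ^ 2 / 4 := by
    rw [← le_div_iff₀ (by positivity)]
    exact min_le_right _ _
  refine ⟨η ^ 2, by positivity, fun hbar hh0 hhη ς _ X hX => ?_⟩
  set G : ℝ → ℝ := fun x => q ^ 2 / 4 * (adaptiveStep f g hbar x * g x ^ 2) * |x| ^ q with hG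
  have hGm : Measurable G := by
    have := hfg.measurable_g
    have := hfg.measurable_adaptiveStep (hbar := hbar)
    fun_prop
  have hGc : ContinuousOn G {0}ᶜ := by
    have h1 : ContinuousOn (adaptiveStep f g hbar) {0}ᶜ := by
      refine continuousOn_const.div ((continuousOn_const.add hf).add (hg.pow 2)) fun x _ => ?_
      have := hfg.f_nonneg x
      positivity
    exact (continuousOn_const.mul (h1.mul (hg.pow 2))).mul
      (continuous_abs.continuousOn.rpow_const fun x _ => Or.inr hq0.le)
  have hG0 (u : ℝ) (hu : u ≠ 0) : 0 < G u := by
    have := hfg.f_nonneg u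
    have := (hfg.g_nonneg u).lt_of_ne' (hfg.g_ne_zero u hu)
    simp only [hG, adaptiveStep]
    positivity
  refine (hX.ae_tendsto_of_dissipation hfg hχ hq0 (D := fun x => ENNReal.ofReal (G x))
    (by fun_prop) fun n x => ?_).mono fun ω ⟨⟨c, hc⟩, hω⟩ =>
      tendsto_zero_of_dissipation hq0 hc hGc hG0 hω
  rcases eq_or_ne x 0 with rfl | hx
  · simp [hG, hq0, hq0.ne']
  set a := adaptiveStep f g hbar x * f x with ha
  set b := √(adaptiveStep f g hbar x) * g x with hb
  have hst := hfg.adaptiveStep_nonneg hh0.le x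
  have ha0 : 0 ≤ a := mul_nonneg hst (hfg.f_nonneg x)
  have hb0 : 0 ≤ b := mul_nonneg (Real.sqrt_nonneg _) (hfg.g_nonneg x)
  have hb2 : b ^ 2 = adaptiveStep f g hbar x * g x ^ 2 := hfg.sq_sqrt_step_mul_g hh0.le x
  have hab : a ≤ β / 2 * b ^ 2 := by
    rw [hb2, ha]
    have := mul_le_mul_of_nonneg_left (hfg.f_le_of_isLUB hβ.1 hx) hst
    linarith
  have hreal := one_step_stable hβ0 hβ1 hq hK0 hη1 hη ha0 hb0
    ((hfg.step_mul_f_le hh0.le x).trans hhη) (hfg.sqrt_step_mul_g_le hh0.le hη0.le hhη x) hab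
  have hmom := lintegral_enorm_rpow_le (hχ.mean (n + 1)).1 (hχ.mean (n + 1)).2
    (hχ.second_moment (n + 1)).1 (hχ.second_moment (n + 1)).2 (hK (n + 1)).1 (hK (n + 1)).2
    ha0 hb0 hq0 hq1
  have hGx : ENNReal.ofReal (G x) = ‖x‖ₑ ^ q * ENNReal.ofReal (q ^ 2 / 4 * b ^ 2) := by
    rw [← ofReal_norm, ENNReal.ofReal_rpow_of_nonneg (norm_nonneg _) hq0.le,
      ← ENNReal.ofReal_mul (by positivity), Real.norm_eq_abs, hb2, mul_comm]
  rw [hGx, ← mul_add]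
  refine mul_le_of_le_one_right' ?_
  refine (add_le_add_left hmom _).trans ?_
  -- `ENNReal.ofReal` is additive only on nonnegative reals; if the moment bound is nonpositive, the
  -- dissipation term alone is at most `1`.
  rcases le_total 0 (1 + q * a + q * (q - 1) / 2 * (a ^ 2 + b ^ 2) + 80 * (a ^ 3 + b ^ 3 * K))
    with h | h
  · rw [← ENNReal.ofReal_add h (by positivity)]
    exact ENNReal.ofReal_le_one.2 hreal
  · rw [ENNReal.ofReal_of_nonpos h, zero_add]
    refine ENNReal.ofReal_le_one.2 ?_
    have hb1 : b ≤ 1 := (hfg.sqrt_step_mul_g_le hh0.le hη0.le hhη x).trans hη1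
    have : q ^ 2 / 4 ≤ 1 := by nlinarith
    have : b ^ 2 ≤ 1 := by nlinarith
    exact mul_le_one₀ ‹_› (sq_nonneg b) this

end Stability

/-! ### Instability. -/

/-- Coefficient arithmetic: small steps do not increase the moment of order `-q` when
`a ≥ γ / 2 * b ^ 2`. -/
theorem one_step_unstable {γ K η e a b q : ℝ} (hq0 : 0 < q) (hq1 : q ≤ 1) (hqγ : 2 * q ≤ γ - 1)
    (hK : 0 ≤ K) (hη1 : η ≤ 1) (hη : η * (81 * γ / 2 + 80 * K) ≤ q ^ 2 / 4)
    (hηq : 81 * η ≤ q) (he : e ≤ q ^ 2 / 4)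
    (ha : 0 ≤ a) (hb : 0 ≤ b) (haη : a ≤ η ^ 2) (hbη : b ≤ η) (hab : γ / 2 * b ^ 2 ≤ a) :
    1 - q * a + q * (q + 1) / 2 * (a ^ 2 + b ^ 2) + 80 * (a ^ 3 + b ^ 3 * K) + e * b ^ 2 ≤ 1 := by
  have hη0 : 0 ≤ η := hb.trans hbη
  have haη' : a ≤ η := haη.trans (by nlinarith)
  have ha1 : a ≤ 1 := haη'.trans hη1
  have h2 : a ^ 2 ≤ η * a := by nlinarith
  have h3 : a ^ 3 ≤ η * a := by
    calc a ^ 3 = a ^ 2 * a := by ring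
      _ ≤ a ^ 2 * 1 := by gcongr
      _ ≤ _ := by linarith
  have hq2 : q * (q + 1) / 2 ≤ 1 := by nlinarith
  have h2' : q * (q + 1) / 2 * a ^ 2 ≤ η * a :=
    (mul_le_of_le_one_left (sq_nonneg a) hq2).trans h2
  have h4 : b ^ 3 * K ≤ η * K * b ^ 2 := by
    have : b * (b ^ 2 * K) ≤ η * (b ^ 2 * K) := by gcongr
    linarith
  -- The terms in `a ^ 2` and `80 a ^ 3` cost at most `81 η a`, leaving a drift of `-(q - 81 η) a`.
  have h5 : (γ / 2 * b ^ 2) * (q - 81 * η) ≤ a * (q - 81 * η) :=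
    mul_le_mul_of_nonneg_right hab (by linarith)
  have h6 : 0 ≤ b ^ 2 * (γ / 2 * (q - 81 * η) - q * (q + 1) / 2 - 80 * η * K - e) :=
    mul_nonneg (sq_nonneg b) (by nlinarith)
  nlinarith

/-- Away from `0` nothing compares `a` with `b ^ 2`; this crude bound only keeps negative moments
finite at each time. -/
theorem one_step_bounded {K η e a b q : ℝ} (hq0 : 0 < q) (hq1 : q ≤ 1)
    (hK : 0 ≤ K) (hη1 : η ≤ 1) (he : 0 ≤ e)
    (ha : 0 ≤ a) (hb : 0 ≤ b) (haη : a ≤ η ^ 2) (hbη : b ≤ η) :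
    1 - q * a + q * (q + 1) / 2 * (a ^ 2 + b ^ 2) + 80 * (a ^ 3 + b ^ 3 * K) + e * b ^ 2
      ≤ 83 + 80 * K + e := by
  have ha1 : a ≤ 1 := haη.trans (by nlinarith)
  have hb1 : b ≤ 1 := hbη.trans hη1
  have h0 : 0 ≤ q * a := by positivity
  have h1 : a ^ 2 ≤ 1 := pow_le_one₀ ha ha1
  have h2 : b ^ 2 ≤ 1 := pow_le_one₀ hb hb1
  have h3 : a ^ 3 ≤ 1 := pow_le_one₀ ha ha1
  have h4 : b ^ 3 * K ≤ K := mul_le_of_le_one_left hK (pow_le_one₀ hb hb1)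
  have h5 : e * b ^ 2 ≤ e := mul_le_of_le_one_right he h2
  have h6 : q * (q + 1) / 2 * (a ^ 2 + b ^ 2) ≤ 1 * (a ^ 2 + b ^ 2) := by
    gcongr
    nlinarith
  linarith

section Instability

variable {Ω : Type*} [MeasurableSpace Ω] {P : Measure Ω} [IsProbabilityMeasure P] {f g : ℝ → ℝ}
  {hbar : ℝ} {χ : ℕ → Ω → ℝ} {ς : ℝ} {X : ℕ → Ω → ℝ}

/-- If negative moments stay finite and do not increase near `0`, the solution does not tend
to `0`. -/
theorem IsAdaptiveSolution.ae_not_tendsto_zero (hX : IsAdaptiveSolution f g hbar χ ς X)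
    (hς : ς ≠ 0) (hfg : IsCoefficientPair f g) (hχ : IsNoise P χ) {q δ : ℝ} (hq : 0 < q)
    (hδ : 0 < δ) {M : ENNReal} (hM : M ≠ ⊤)
    (hbdd : ∀ n x, ∫⁻ ω', ‖1 + (adaptiveStep f g hbar x * f x
      + √(adaptiveStep f g hbar x) * g x * χ (n + 1) ω')‖ₑ ^ (-q) ∂P ≤ M)
    (hle : ∀ n x, x ≠ 0 → |x| < δ → ∫⁻ ω', ‖1 + (adaptiveStep f g hbar x * f x
      + √(adaptiveStep f g hbar x) * g x * χ (n + 1) ω')‖ₑ ^ (-q) ∂P ≤ 1) :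
    ∀ᵐ ω ∂P, ¬ Tendsto (fun n => X n ω) atTop (𝓝 0) := by
  have hXm' := hX.measurable hfg hχ
  have hXm n : Measurable (X n) := (hXm' n).mono (hχ.filtration.le n) le_rfl
  -- In `ENNReal` the power `0 ^ (-q)` is `⊤`, so finiteness also rules out hitting `0`.
  have hfin (n : ℕ) : ∫⁻ ω, ‖X n ω‖ₑ ^ (-q) ∂P ≠ ⊤ := by
    induction n with
    | zero => simp [hX.init, hς]
    | succ n ih =>
      have := hX.setLIntegral_rpow_succ_le hfg hχ n (-q) MeasurableSet.univ (D := 0)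
        measurable_zero (c := fun x => ‖x‖ₑ ^ (-q) * M) fun ω _ => by
          simp only [Pi.zero_apply, add_zero]
          gcongr
          exact hbdd n _
      simp only [Measure.restrict_univ, Pi.zero_apply, add_zero] at this
      refine ne_top_of_le_ne_top ?_ this
      rw [lintegral_mul_const _ (by have := hXm n; fun_prop)]
      exact ENNReal.mul_ne_top ih hM
  -- These events are known at time `n` and decrease in `n`, so localising preserves the
  -- monotonicity of the moment.
  let A (N n : ℕ) : Set Ω := {ω | ∀ k ∈ Set.Icc N n, |X k ω| < δ}
  have hA (N n : ℕ) : MeasurableSet[hχ.filtration n] (A N n) := by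
    have : A N n = ⋂ k ∈ Set.Icc N n, {ω | |X k ω| < δ} := by ext; simp [A]
    rw [this]
    refine MeasurableSet.biInter (Set.to_countable _) fun k hk => ?_
    have hk' : Measurable[hχ.filtration n] (X k) :=
      (hXm' k).mono (hχ.filtration.mono hk.2) le_rfl
    exact hk' (measurableSet_lt (f := fun x : ℝ => |x|) (by fun_prop) measurable_const)
  have hmono (N n : ℕ) (hn : N ≤ n) : ∫⁻ ω in A N (n + 1), ‖X (n + 1) ω‖ₑ ^ (-q) ∂P
      ≤ ∫⁻ ω in A N n, ‖X n ω‖ₑ ^ (-q) ∂P := by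
    have hsub : A N (n + 1) ⊆ A N n := fun ω hω k hk => hω k ⟨hk.1, hk.2.trans n.le_succ⟩
    refine (lintegral_mono_set hsub).trans ?_
    have := hX.setLIntegral_rpow_succ_le hfg hχ n (-q) (hA N n) (D := 0) measurable_zero
      (c := fun x => ‖x‖ₑ ^ (-q)) fun ω hω => by
        simp only [Pi.zero_apply, add_zero]
        rcases eq_or_ne (X n ω) 0 with h | h
        · simp [h, hq]
        · exact mul_le_of_le_one_right' (hle n _ h (hω n ⟨hn, le_rfl⟩))
    simpa using this
  have hbound (N n : ℕ) : ∫⁻ ω in A N (N + n), ‖X (N + n) ω‖ₑ ^ (-q) ∂P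
      ≤ ∫⁻ ω, ‖X N ω‖ₑ ^ (-q) ∂P := by
    induction n with
    | zero => exact setLIntegral_le_lintegral _ _
    | succ n ih => exact (hmono N (N + n) (Nat.le_add_right _ _)).trans ih
  have hfatou (N : ℕ) : ∀ᵐ ω ∂P, (∀ k, N ≤ k → |X k ω| < δ) →
      liminf (fun n => ‖X (N + n) ω‖ₑ ^ (-q)) atTop < ⊤ := by
    set E : Set Ω := {ω | ∀ k, N ≤ k → |X k ω| < δ} with hE
    have hEm : MeasurableSet E := by
      have : E = ⋂ k, ⋂ _ : N ≤ k, {ω | |X k ω| < δ} := by ext; simp [hE]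
      rw [this]
      exact MeasurableSet.iInter fun k => MeasurableSet.iInter fun _ =>
        measurableSet_lt (hXm k).abs measurable_const
    have hmeas (n : ℕ) : Measurable fun ω => ‖X (N + n) ω‖ₑ ^ (-q) := by
      have := hXm (N + n)
      fun_prop
    refine (ae_restrict_iff' hEm).1 (ae_lt_top (.liminf hmeas) (ne_top_of_le_ne_top (hfin N) ?_))
    refine (lintegral_liminf_le hmeas).trans ?_
    refine liminf_le_of_le (by isBoundedDefault) fun b hb => ?_
    obtain ⟨n, hn⟩ := hb.exists
    have hsub : E ⊆ A N (N + n) := fun ω hω k hk => hω k hk.1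
    exact hn.trans ((lintegral_mono_set hsub).trans (hbound N n))
  filter_upwards [ae_all_iff.2 hfatou] with ω hω hlim
  have hev : ∀ᶠ k in atTop, |X k ω| < δ := by
    have := hlim.abs
    rw [abs_zero] at this
    exact this.eventually (gt_mem_nhds hδ)
  obtain ⟨N, hN⟩ := eventually_atTop.1 hev
  refine (hω N hN).ne (Tendsto.liminf_eq ?_)
  have h1 : Tendsto (fun n => ‖X (N + n) ω‖ₑ) atTop (𝓝 0) := by
    have := (hlim.comp (tendsto_add_atTop_nat N)).enorm
    simpa [Function.comp_def, add_comm] using this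
  have h2 := ((ENNReal.continuous_rpow_const (y := -q)).tendsto 0).comp h1
  simpa [Function.comp_def, hq] using h2

theorem exists_step_bound_not_tendsto_zero (hfg : IsCoefficientPair f g) (hχ : IsNoise P χ)
    {γ δ : ℝ} (hγ : 1 < γ) (hδ : 0 < δ)
    (hfγ : ∀ u, u ≠ 0 → |u| < δ → γ / 2 * g u ^ 2 ≤ f u) :
    ∃ h₀ : ℝ, 0 < h₀ ∧ ∀ hbar : ℝ, 0 < hbar → hbar ≤ h₀ → ∀ ς : ℝ, 0 < ς →
      ∀ X : ℕ → Ω → ℝ, IsAdaptiveSolution f g hbar χ ς X →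
        ∀ᵐ ω ∂P, ¬ Tendsto (fun n => X n ω) atTop (𝓝 0) := by
  obtain ⟨K, hK⟩ := hχ.third_moment
  have hK0 : 0 ≤ K := (integral_nonneg fun ω => by positivity).trans (hK 0).2
  obtain ⟨p, hpm, hp0, hlaw, htail⟩ := hχ.density
  -- The cap `1 / 2` makes `|z| ^ (-q)` integrable at `0`.
  set q := min ((γ - 1) / 2) (1 / 2) with hq
  have hq0 : 0 < q := lt_min (by linarith) (by norm_num)
  have hq1 : q < 1 := (min_le_right _ _).trans_lt (by norm_num)
  have hqγ : 2 * q ≤ γ - 1 := by linarith [min_le_left ((γ - 1) / 2) (1 / 2)]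
  set C := (∫⁻ z : ℝ in {z | |z| < 1 / 2}, ‖z‖ₑ ^ (-q)).toReal with hC
  have hC0 : 0 ≤ C := ENNReal.toReal_nonneg
  set ε := q ^ 2 / 4 / (8 * (C + 1)) with hε
  have hε0 : 0 < ε := by positivity
  have he : 8 * ε * C ≤ q ^ 2 / 4 := by
    calc 8 * ε * C ≤ 8 * ε * (C + 1) := by gcongr; linarith
      _ = q ^ 2 / 4 := by rw [hε]; field_simp
  obtain ⟨R, hR⟩ := htail ε hε0
  -- The last bound puts the singular set inside the tail `|x| ≥ R`; the others serve
  -- `one_step_unstable`.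
  set η := min (min 1 (q / 81)) (min (q ^ 2 / 4 / (81 * γ / 2 + 80 * K)) (1 / (2 * (|R| + 1))))
    with hηdef
  have hη0 : 0 < η := by positivity
  have hη1 : η ≤ 1 := (min_le_left _ _).trans (min_le_left _ _)
  have hηq : 81 * η ≤ q := by
    have : η ≤ q / 81 := (min_le_left _ _).trans (min_le_right _ _)
    linarith
  have hη : η * (81 * γ / 2 + 80 * K) ≤ q ^ 2 / 4 := by
    rw [← le_div_iff₀ (by positivity)]
    exact (min_le_right _ _).trans (min_le_left _ _)
  have hηR : η * (2 * (|R| + 1)) ≤ 1 := by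
    rw [← le_div_iff₀ (by positivity)]
    exact (min_le_right _ _).trans (min_le_right _ _)
  refine ⟨η ^ 2, by positivity, fun hbar hh0 hhη ς hς X hX => ?_⟩
  have hmom (n : ℕ) (x : ℝ) := by
    have hbη := hfg.sqrt_step_mul_g_le hh0.le hη0.le hhη x
    have hb0 : 0 ≤ √(adaptiveStep f g hbar x) * g x :=
      mul_nonneg (Real.sqrt_nonneg _) (hfg.g_nonneg x)
    refine lintegral_enorm_rpow_neg_le (hχ.measurable (n + 1)) (hχ.mean (n + 1)).1
      (hχ.mean (n + 1)).2 (hχ.second_moment (n + 1)).1 (hχ.second_moment (n + 1)).2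
      (hK (n + 1)).1 (hK (n + 1)).2 (hpm _) (hp0 _) (hlaw _) (hR (n + 1))
      (mul_nonneg (hfg.adaptiveStep_nonneg hh0.le x) (hfg.f_nonneg x)) hb0 hq0 hq1 ?_
    calc R * (2 * (√(adaptiveStep f g hbar x) * g x))
        ≤ (|R| + 1) * (2 * η) := by
          gcongr
          linarith [le_abs_self R]
      _ ≤ 1 := by linarith
  refine hX.ae_not_tendsto_zero hς.ne' hfg hχ hq0 hδ
    (M := ENNReal.ofReal (83 + 80 * K + 8 * ε * C)) ENNReal.ofReal_ne_top
    (fun n x => (hmom n x).trans (ENNReal.ofReal_le_ofReal ?_))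
    (fun n x hx hxδ => (hmom n x).trans (ENNReal.ofReal_le_one.2 ?_))
  · exact one_step_bounded hq0 hq1.le hK0 hη1 (by positivity)
      (mul_nonneg (hfg.adaptiveStep_nonneg hh0.le x) (hfg.f_nonneg x))
      (mul_nonneg (Real.sqrt_nonneg _) (hfg.g_nonneg x))
      ((hfg.step_mul_f_le hh0.le x).trans hhη) (hfg.sqrt_step_mul_g_le hh0.le hη0.le hhη x)
  · refine one_step_unstable hq0 hq1.le hqγ hK0 hη1 hη hηq he
      (mul_nonneg (hfg.adaptiveStep_nonneg hh0.le x) (hfg.f_nonneg x))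
      (mul_nonneg (Real.sqrt_nonneg _) (hfg.g_nonneg x))
      ((hfg.step_mul_f_le hh0.le x).trans hhη) (hfg.sqrt_step_mul_g_le hh0.le hη0.le hhη x) ?_
    rw [hfg.sq_sqrt_step_mul_g hh0.le]
    have := mul_le_mul_of_nonneg_left (hfγ x hx hxδ) (hfg.adaptiveStep_nonneg hh0.le x)
    linarith

end Instability

theorem IsCoefficientPair.exists_le_f_of_lt_liminf {f g : ℝ → ℝ} (hfg : IsCoefficientPair f g)
    (h : 1 < liminf (fun u : ℝ => ((2 * f u / g u ^ 2 : ℝ) : EReal)) (𝓝[≠] 0)) :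
    ∃ γ δ : ℝ, 1 < γ ∧ 0 < δ ∧ ∀ u, u ≠ 0 → |u| < δ → γ / 2 * g u ^ 2 ≤ f u := by
  -- A real `γ` strictly between also handles an infinite lower limit.
  obtain ⟨γ, hγ1, hγ⟩ := EReal.lt_iff_exists_real_btwn.1 h
  have hev := eventually_lt_of_lt_liminf hγ
  obtain ⟨δ, hδ, hball⟩ := Metric.eventually_nhds_iff.1 (eventually_nhdsWithin_iff.1 hev)
  refine ⟨γ, δ, by exact_mod_cast hγ1, hδ, fun u hu huδ => ?_⟩
  have h1 : γ < 2 * f u / g u ^ 2 :=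
    EReal.coe_lt_coe_iff.1 (hball (by simpa [Real.dist_eq] using huδ) hu)
  have : 0 < g u ^ 2 := pow_pos ((hfg.g_nonneg u).lt_of_ne' (hfg.g_ne_zero u hu)) 2
  rw [lt_div_iff₀ this] at h1
  linarith

theorem theorem3p1 {Ω : Type*} [MeasurableSpace Ω] (P : Measure Ω) [IsProbabilityMeasure P]
    (f g : ℝ → ℝ) (hfg : IsCoefficientPair f g)
    (χ : ℕ → Ω → ℝ) (hχ : IsNoise P χ) :
    (ContinuousOn f {0}ᶜ → ContinuousOn g {0}ᶜ →
      (∃ β : ℝ, β < 1 ∧ IsLUB ((fun u : ℝ => 2 * f u / g u ^ 2) '' {u | u ≠ 0}) β) →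
      ∃ h₀ : ℝ, 0 < h₀ ∧ ∀ hbar : ℝ, 0 < hbar → hbar ≤ h₀ → ∀ ς : ℝ, 0 < ς →
        ∀ X : ℕ → Ω → ℝ, IsAdaptiveSolution f g hbar χ ς X →
          ∀ᵐ ω ∂P, Tendsto (fun n => X n ω) atTop (𝓝 0)) ∧
    (1 < liminf (fun u : ℝ => ((2 * f u / g u ^ 2 : ℝ) : EReal)) (𝓝[≠] 0) →
      ∃ h₀ : ℝ, 0 < h₀ ∧ ∀ hbar : ℝ, 0 < hbar → hbar ≤ h₀ → ∀ ς : ℝ, 0 < ς →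
        ∀ X : ℕ → Ω → ℝ, IsAdaptiveSolution f g hbar χ ς X →
          P {ω | Tendsto (fun n => X n ω) atTop (𝓝 0)} = 0) := by
  refine ⟨fun hf hg ⟨β, hβ1, hβ⟩ => exists_step_bound_tendsto_zero hfg hχ hf hg hβ1 hβ,
    fun h => ?_⟩
  obtain ⟨γ, δ, hγ, hδ, hfγ⟩ := hfg.exists_le_f_of_lt_liminf h
  obtain ⟨h₀, hh₀, H⟩ := exists_step_bound_not_tendsto_zero hfg hχ hγ hδ hfγ
  refine ⟨h₀, hh₀, fun hbar hpos hle ς hς X hX => ?_⟩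
  simpa [ae_iff] using H hbar hpos hle ς hς X hX
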